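/- Let $\Phi_0,\Phi_1,\dots$ be a standard (acceptable) numbering of the partial computable functions $\omega\to\omega$. Kleene's first model $\mathcal{K}_1$ is the set $\omega$ with the partial application operation $n\cdot m=\Phi_n(m)$. The closed terms over $\mathcal{K}_1$ are built from the elements of $\mathcal{K}_1$ by formal application $(s,t)\mapsto st$, and are coded effectively by natural numbers. For closed terms write $s\simeq t$ if either both $s$ and $t$ are undefined, or both are defined (all their subterms being defined) and have the same value. For each ordinal $\alpha$ define a relation $\sim_\alpha$ on closed terms by transfinite recursion: \[ \begin{aligned} s\sim_0 t &\iff s\simeq t,\\ s\sim_{\alpha+1}t &\iff \forall x\in\mathcal{K}_1\;\; sx\sim_\alpha tx,\\ s\sim_\alpha t &\iff \exists\beta<\alpha\;\; s\sim_\beta t\qquad\text{for } \alpha \text{ a limit ordinal}. \end{aligned} \] Let $s\approx t$ mean that $s\sim_\alpha t$ for some ordinal $\alpha$. A set $Q$ of natural numbers (or of pairs of natural numbers, or of pairs of closed terms) is $\Pi^1_1$ if there is a computably enumerable relation $R$ such that $x\in Q\iff\forall f\in\omega^\omega\,\exists n\, R(x,\langle f(0),\dots,f(n-1)\rangle)$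 for all $x$. It is $\Pi^1_1$-complete if it is $\Pi^1_1$ and every $\Pi^1_1$ set of natural numbers is many-one reducible to it. **Theorem.** The relation $\approx$ on $\mathcal{K}_1$ is $\Pi^1_1$-complete, both as a relation on the elements of $\mathcal{K}_1$ and as a relation on the closed terms over $\mathcal{K}_1$. -/

import Mathlib

namespace PCA

/-! ### Partial applicative structures, closed terms and higher extensionality -/

/-- A partial applicative structure on `A`: a partial map from `A × A` to `A`. -/
structure PartialApplicativeStructure (A : Type) where
  app : A → A → Part A

/-- Closed terms over `A`: every element of `A` is a closed term, and if `s` and `t` are closed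
terms, then so is `(s · t)`. -/
inductive ClosedTerm (A : Type) : Type where
  | elem : A → ClosedTerm A
  | app : ClosedTerm A → ClosedTerm A → ClosedTerm A

variable {A : Type}

/-- The value of a closed term; it is defined iff all subterms are defined. -/
def PartialApplicativeStructure.eval (M : PartialApplicativeStructure A) :
    ClosedTerm A → Part A
  | ClosedTerm.elem a => Part.some a
  | ClosedTerm.app s t => (M.eval s).bind fun a => (M.eval t).bind fun b => M.app a b

/-- Kleene equality `s ≃ t`: both undefined, or both defined with the same value. -/
def PartialApplicativeStructure.KleeneEq (M : PartialApplicativeStructure A)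
    (s t : ClosedTerm A) : Prop :=
  M.eval s = M.eval t

/-- The extensionality relations `s ∼_α t`, by transfinite recursion on the ordinal `α`:
Kleene equality at `0`; `∀ x ∈ A, s x ∼_α t x` at `α + 1`; the union of the earlier
relations at limits. -/
noncomputable def PartialApplicativeStructure.Sim (M : PartialApplicativeStructure A)
    (α : Ordinal.{0}) : ClosedTerm A → ClosedTerm A → Prop :=
  Ordinal.limitRecOn (motive := fun _ => ClosedTerm A → ClosedTerm A → Prop) α
    M.KleeneEq
    (fun _ ih s t => ∀ x : A, ih (s.app (ClosedTerm.elem x)) (t.app (ClosedTerm.elem x)))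
    (fun α _ ih s t => ∃ β : Ordinal.{0}, ∃ h : β < α, ih β h s t)

theorem PartialApplicativeStructure.sim_zero (M : PartialApplicativeStructure A)
    (s t : ClosedTerm A) : M.Sim 0 s t ↔ M.KleeneEq s t := by
  simp [PartialApplicativeStructure.Sim]

theorem PartialApplicativeStructure.sim_succ (M : PartialApplicativeStructure A)
    (α : Ordinal.{0}) (s t : ClosedTerm A) :
    M.Sim (α + 1) s t ↔
      ∀ x : A, M.Sim α (s.app (ClosedTerm.elem x)) (t.app (ClosedTerm.elem x)) := by
  simp [PartialApplicativeStructure.Sim]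

theorem PartialApplicativeStructure.sim_limit (M : PartialApplicativeStructure A)
    (α : Ordinal.{0}) (hα : Order.IsSuccLimit α) (s t : ClosedTerm A) :
    M.Sim α s t ↔ ∃ β < α, M.Sim β s t := by
  unfold PartialApplicativeStructure.Sim
  rw [Ordinal.limitRecOn_limit _ _ _ _ hα]
  simp

/-- The limit relation `s ≈ t`: `s ∼_α t` for some ordinal `α`. -/
def PartialApplicativeStructure.Approx (M : PartialApplicativeStructure A)
    (s t : ClosedTerm A) : Prop :=
  ∃ α : Ordinal.{0}, M.Sim α s t

/-- Kleene's first model: `n · m = Φ_n(m)`, with `Φ_n` the `n`-th partial computable function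
in Mathlib's standard numbering of programs. -/
def K₁ : PartialApplicativeStructure ℕ where
  app n m := (Denumerable.ofNat Nat.Partrec.Code n).eval m

/-! ### An effective coding of the closed terms over `ℕ` -/

/-- The code of a closed term over `ℕ`. -/
def ClosedTerm.code : ClosedTerm ℕ → ℕ
  | ClosedTerm.elem a => 2 * a
  | ClosedTerm.app s t => 2 * Nat.pair s.code t.code + 1

/-- The closed term over `ℕ` with a given code. -/
def ClosedTerm.ofCode (n : ℕ) : ClosedTerm ℕ :=
  if h : n % 2 = 0 then ClosedTerm.elem (n / 2)
  else
    have h₁ : (n / 2).unpair.1 < n := lt_of_le_of_lt (Nat.unpair_left_le _) (by omega)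
    have h₂ : (n / 2).unpair.2 < n := lt_of_le_of_lt (Nat.unpair_right_le _) (by omega)
    ClosedTerm.app (ClosedTerm.ofCode (n / 2).unpair.1) (ClosedTerm.ofCode (n / 2).unpair.2)
termination_by n

theorem ClosedTerm.ofCode_code (t : ClosedTerm ℕ) : ClosedTerm.ofCode t.code = t := by
  induction t with
  | elem a => rw [ClosedTerm.code, ClosedTerm.ofCode]; simp
  | app s t hs ht =>
    rw [ClosedTerm.code, ClosedTerm.ofCode]
    have e : (2 * Nat.pair s.code t.code + 1) / 2 = Nat.pair s.code t.code := by omega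
    have e' : ¬ (2 * Nat.pair s.code t.code + 1) % 2 = 0 := by omega
    rw [dif_neg e']
    simp only [e, Nat.unpair_pair, hs, ht]

theorem ClosedTerm.code_ofCode (n : ℕ) : (ClosedTerm.ofCode n).code = n := by
  induction n using Nat.strong_induction_on with
  | _ n ih =>
    rw [ClosedTerm.ofCode]
    split_ifs with h
    · rw [ClosedTerm.code]; omega
    · have h₁ : (n / 2).unpair.1 < n := lt_of_le_of_lt (Nat.unpair_left_le _) (by omega)
      have h₂ : (n / 2).unpair.2 < n := lt_of_le_of_lt (Nat.unpair_right_le _) (by omega)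
      rw [ClosedTerm.code, ih _ h₁, ih _ h₂, Nat.pair_unpair]
      omega

/-- Closed terms over `ℕ` are effectively in bijection with `ℕ`. -/
def ClosedTerm.equivNat : ClosedTerm ℕ ≃ ℕ where
  toFun := ClosedTerm.code
  invFun := ClosedTerm.ofCode
  left_inv := ClosedTerm.ofCode_code
  right_inv := ClosedTerm.code_ofCode

instance ClosedTerm.instPrimcodable : Primcodable (ClosedTerm ℕ) :=
  Primcodable.ofEquiv ℕ ClosedTerm.equivNat

/-! ### Lightface `Π¹₁` sets and completeness -/

/-- A relation `P(x, f)` between codable objects `x` and functions `f : ℕ → ℕ` is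
(lightface) `Σ⁰₁`, i.e. semirecursive, if it is a computably enumerable union of basic open
sets: there is a c.e. set `R` such that `P(x, f)` holds iff `(x, σ) ∈ R` for some finite initial
segment `σ = ⟨f(0), …, f(n-1)⟩` of `f`. -/
def IsSigma01 {α : Type} [Primcodable α] (P : α → (ℕ → ℕ) → Prop) : Prop :=
  ∃ R : α × List ℕ → Prop, REPred R ∧
    ∀ (x : α) (f : ℕ → ℕ), P x f ↔ ∃ n : ℕ, R (x, (List.range n).map f)

/-- A predicate is (lightface) `Π¹₁` if it has the form `∀ f : ℕ → ℕ, P(x, f)`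
with `P` a `Σ⁰₁` relation. -/
def IsPi11 {α : Type} [Primcodable α] (p : α → Prop) : Prop :=
  ∃ P : α → (ℕ → ℕ) → Prop, IsSigma01 P ∧ ∀ x : α, p x ↔ ∀ f : ℕ → ℕ, P x f

/-- A predicate is `Π¹₁`-hard if every `Π¹₁` set of natural numbers is many-one reducible
to it (by a total computable function). -/
def IsPi11Hard {α : Type} [Primcodable α] (p : α → Prop) : Prop :=
  ∀ q : ℕ → Prop, IsPi11 q → ManyOneReducible q p

/-- A predicate is `Π¹₁`-complete if it is `Π¹₁` and `Π¹₁`-hard. -/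
def IsPi11Complete {α : Type} [Primcodable α] (p : α → Prop) : Prop :=
  IsPi11 p ∧ IsPi11Hard p

end PCA

namespace PCA

open Nat.Partrec (Code)
open Encodable Denumerable

/-! ### Higher extensionality along infinite branches -/

/-! The relation `≈` unfolds along branches (`approx_iff`): `s ≈ t` iff on every infinite sequence
of arguments the two terms become Kleene equal after finitely many of them. For the upper bound
(`isPi11_approx`), Kleene equality is not semirecursive, since it allows both sides to diverge; the
offending quantifier over stages is absorbed into the universally quantified function. For hardness
(`isPi11Hard_approx_elem`), the recursion theorem gives two labelled copies of a tree of elements.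
Applying an element moves to a child, and at nodes accepted by a decidable relation the result is
`0`. Injectivity keeps the two copies apart until a node is accepted, so the roots are related iff
every branch meets an accepted node. -/

/-- The closed term `t x₁ ⋯ xₙ`. -/
def ClosedTerm.applyList {A : Type} (t : ClosedTerm A) (l : List A) : ClosedTerm A :=
  l.foldl (fun s x => s.app (ClosedTerm.elem x)) t

section Branches

variable {A : Type} (M : PartialApplicativeStructure A)

theorem ClosedTerm.applyList_append_singleton (t : ClosedTerm A) (l : List A) (x : A) :
    t.applyList (l ++ [x]) = (t.applyList l).app (ClosedTerm.elem x) := by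
  simp [ClosedTerm.applyList]

theorem ClosedTerm.applyList_cons (t : ClosedTerm A) (l : List A) (x : A) :
    t.applyList (x :: l) = (t.app (ClosedTerm.elem x)).applyList l := rfl

theorem PartialApplicativeStructure.KleeneEq.app {M : PartialApplicativeStructure A}
    {s t : ClosedTerm A} (h : M.KleeneEq s t) (x : A) :
    M.KleeneEq (s.app (ClosedTerm.elem x)) (t.app (ClosedTerm.elem x)) := by
  unfold PartialApplicativeStructure.KleeneEq at *
  simp only [PartialApplicativeStructure.eval, h]

/-- This is the inclusion of level `α` in level `α + 1`, hence the successor step of `Sim.mono`. -/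
theorem PartialApplicativeStructure.Sim.app {M : PartialApplicativeStructure A}
    {α : Ordinal.{0}} {s t : ClosedTerm A} (h : M.Sim α s t) (x : A) :
    M.Sim α (s.app (ClosedTerm.elem x)) (t.app (ClosedTerm.elem x)) := by
  induction α using Ordinal.limitRecOn generalizing s t x with
  | zero => exact (M.sim_zero _ _).2 (((M.sim_zero _ _).1 h).app x)
  | add_one α ih =>
    rw [M.sim_succ] at h ⊢
    exact fun y => ih (h x) y
  | limit α hα ih =>
    obtain ⟨β, hβ, h⟩ := (M.sim_limit α hα _ _).1 h
    exact (M.sim_limit α hα _ _).2 ⟨β, hβ, ih β hβ h x⟩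

theorem PartialApplicativeStructure.Sim.mono {M : PartialApplicativeStructure A}
    {α β : Ordinal.{0}} (hαβ : α ≤ β) {s t : ClosedTerm A} (h : M.Sim α s t) : M.Sim β s t := by
  induction β using Ordinal.limitRecOn with
  | zero => rwa [← nonpos_iff_eq_zero.1 hαβ]
  | add_one β ih =>
    rcases hαβ.lt_or_eq with hlt | rfl
    · rw [M.sim_succ]
      exact fun x => (ih (Order.lt_add_one_iff.1 hlt)).app x
    · exact h
  | limit β hβ _ =>
    rcases hαβ.lt_or_eq with hlt | rfl
    · exact (M.sim_limit β hβ _ _).2 ⟨α, hlt, h⟩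
    · exact h

theorem PartialApplicativeStructure.approx_of_forall_app [Countable A] {s t : ClosedTerm A}
    (h : ∀ x, M.Approx (s.app (ClosedTerm.elem x)) (t.app (ClosedTerm.elem x))) :
    M.Approx s t := by
  choose α hα using h
  -- By monotonicity all the witnessing levels can be raised to their supremum.
  refine ⟨(⨆ x, α x) + 1, (M.sim_succ _ _ _).2 fun x => (hα x).mono ?_⟩
  exact Ordinal.le_iSup α x

/-- Two closed terms are related by `≈` iff they become Kleene equal along every infinite
sequence of arguments. -/
theorem PartialApplicativeStructure.approx_iff [Countable A] {s t : ClosedTerm A} :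
    M.Approx s t ↔ ∀ f : ℕ → A, ∃ n,
      M.KleeneEq (s.applyList ((List.range n).map f)) (t.applyList ((List.range n).map f)) := by
  constructor
  · rintro ⟨α, h⟩
    induction α using Ordinal.limitRecOn generalizing s t with
    | zero => exact fun f => ⟨0, (M.sim_zero _ _).1 h⟩
    | add_one α ih =>
      intro f
      rw [M.sim_succ] at h
      obtain ⟨n, hn⟩ := ih (h (f 0)) fun k => f (k + 1)
      refine ⟨n + 1, ?_⟩
      simpa [List.range_succ_eq_map, ClosedTerm.applyList_cons, Function.comp_def] using hn
    | limit α hα ih =>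
      obtain ⟨β, hβ, h⟩ := (M.sim_limit α hα _ _).1 h
      exact ih β hβ h
  -- An unrelated pair has an argument at which it stays unrelated. Iterating this choice yields a
  -- branch with no Kleene equality, as Kleene equality is level `0`.
  · intro H
    by_contra hst
    let Bad := {p : ClosedTerm A × ClosedTerm A // ¬ M.Approx p.1 p.2}
    have step : ∀ p : Bad, ∃ x, ¬ M.Approx (p.1.1.app (ClosedTerm.elem x))
        (p.1.2.app (ClosedTerm.elem x)) := fun p => by
      by_contra! h
      exact p.2 (M.approx_of_forall_app h)
    choose next hnext using step
    let seq : ℕ → Bad := fun n => Nat.rec ⟨(s, t), hst⟩ (fun _ p =>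
      ⟨(p.1.1.app (ClosedTerm.elem (next p)), p.1.2.app (ClosedTerm.elem (next p))), hnext p⟩) n
    have hseq : ∀ n, (seq n).1 =
        (s.applyList ((List.range n).map fun k => next (seq k)),
          t.applyList ((List.range n).map fun k => next (seq k))) := by
      intro n
      induction n with
      | zero => rfl
      | succ n ih =>
        rw [List.range_succ, List.map_append, List.map_singleton,
          ClosedTerm.applyList_append_singleton, ClosedTerm.applyList_append_singleton]
        change (_, _) = _
        rw [ih]
    obtain ⟨n, hn⟩ := H fun k => next (seq k)
    refine (seq n).2 ⟨0, (M.sim_zero _ _).2 ?_⟩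
    rw [hseq n]
    exact hn

end Branches

/-! ### Computability of the operations on closed terms -/

theorem ClosedTerm.encode_eq_code (t : ClosedTerm ℕ) : encode t = t.code := rfl

theorem ClosedTerm.primrec_elem : Primrec (ClosedTerm.elem : ℕ → ClosedTerm ℕ) :=
  Primrec.encode_iff.1 (Primrec.nat_mul.comp (Primrec.const 2) Primrec.id)

theorem ClosedTerm.primrec_app :
    Primrec₂ (ClosedTerm.app : ClosedTerm ℕ → ClosedTerm ℕ → ClosedTerm ℕ) :=
  Primrec.encode_iff.1 (Primrec.succ.comp (Primrec.nat_mul.comp (Primrec.const 2)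
    (Primrec₂.natPair.comp (Primrec.encode.comp Primrec.fst) (Primrec.encode.comp Primrec.snd))))

theorem ClosedTerm.primrec_applyList :
    Primrec₂ (ClosedTerm.applyList : ClosedTerm ℕ → List ℕ → ClosedTerm ℕ) :=
  Primrec.list_foldl Primrec.snd Primrec.fst
    (ClosedTerm.primrec_app.comp (Primrec.fst.comp Primrec.snd)
      (ClosedTerm.primrec_elem.comp (Primrec.snd.comp Primrec.snd))).to₂

/-- Evaluation of closed terms in Kleene's first model is partial computable. -/
theorem exists_code_eval : ∃ c : Code, ∀ t : ClosedTerm ℕ, c.eval t.code = K₁.eval t := by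
  -- The parity of a code separates elements from applications; `c` stands for the evaluator itself,
  -- supplied by the recursion theorem.
  let F : Code → ℕ →. ℕ := fun c n =>
    bif n.bodd then
      (c.eval n.div2.unpair.1).bind fun a => (c.eval n.div2.unpair.2).bind fun b =>
        (ofNat Code a).eval b
    else Part.some n.div2
  have hF : Partrec₂ F := by
    have hdiv : Computable fun p : Code × ℕ => p.2.div2 :=
      (Primrec.nat_div2.comp Primrec.snd).to_comp
    have hl : Computable fun p : Code × ℕ => p.2.div2.unpair.1 :=
      Computable.fst.comp (Computable.unpair.comp hdiv)
    have hr : Computable fun p : Code × ℕ => p.2.div2.unpair.2 :=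
      Computable.snd.comp (Computable.unpair.comp hdiv)
    refine Partrec.cond (Primrec.nat_bodd.comp Primrec.snd).to_comp ?_ hdiv.partrec
    refine (Code.eval_part.comp Computable.fst hl).bind
      (Partrec.bind (Code.eval_part.comp (Computable.fst.comp Computable.fst)
        (hr.comp Computable.fst)) ?_)
    exact Code.eval_part.comp
      ((Computable.ofNat Code).comp (Computable.snd.comp Computable.fst)) Computable.snd
  obtain ⟨c, hc⟩ := Code.fixed_point₂ hF
  refine ⟨c, fun t => ?_⟩
  induction t with
  | elem a =>
    rw [hc]
    simp [F, ClosedTerm.code, PartialApplicativeStructure.eval, Nat.div2_val]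
  | app s t hs ht =>
    have e : (2 * Nat.pair s.code t.code + 1) / 2 = Nat.pair s.code t.code := by omega
    rw [hc]
    simp only [F, ClosedTerm.code, PartialApplicativeStructure.eval, Nat.div2_val, e,
      Nat.unpair_pair, hs, ht]
    simp [K₁]

/-! ### The relation `≈` is `Π¹₁` -/

theorem IsPi11.comp {α β : Type} [Primcodable α] [Primcodable β] {p : β → Prop} (hp : IsPi11 p)
    {g : α → β} (hg : Computable g) : IsPi11 fun a => p (g a) := by
  obtain ⟨P, ⟨R, hR, hPR⟩, hp⟩ := hp
  refine ⟨fun a => P (g a), ⟨fun a => R (g a.1, a.2), ?_, fun a => hPR (g a)⟩, fun a => hp (g a)⟩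
  exact Partrec.comp hR ((hg.comp Computable.fst).pair Computable.snd)

theorem isPi11_approx :
    IsPi11 fun p : ClosedTerm ℕ × ClosedTerm ℕ => K₁.Approx p.1 p.2 := by
  obtain ⟨c, hc⟩ := exists_code_eval
  let L : List ℕ → List ℕ := fun l => l.map fun z => z.unpair.1
  -- Each entry codes an argument and a stage. `F` halts iff neither term has converged by the stage
  -- in the last entry, or both converge to one value. On the empty list the lookup fails and `F`
  -- diverges.
  let F : (ClosedTerm ℕ × ClosedTerm ℕ) × List ℕ →. Unit := fun q =>
    (q.2[q.2.length - 1]? : Part ℕ).bind fun z =>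
      bif (c.evaln z.unpair.2 (q.1.1.applyList (L q.2)).code).isNone &&
          (c.evaln z.unpair.2 (q.1.2.applyList (L q.2)).code).isNone then
        Part.some ()
      else (c.eval (q.1.1.applyList (L q.2)).code).bind fun a =>
        (c.eval (q.1.2.applyList (L q.2)).code).bind fun b =>
          bif decide (a = b) then Part.some () else Part.none
  have hF : Partrec F := by
    have hL : Primrec L :=
      Primrec.list_map Primrec.id (Primrec.fst.comp (Primrec.unpair.comp Primrec.snd)).to₂
    have h1 : Primrec fun q : (ClosedTerm ℕ × ClosedTerm ℕ) × List ℕ =>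
        (q.1.1.applyList (L q.2)).code :=
      Primrec.encode.comp (ClosedTerm.primrec_applyList.comp (Primrec.fst.comp Primrec.fst)
        (hL.comp Primrec.snd))
    have h2 : Primrec fun q : (ClosedTerm ℕ × ClosedTerm ℕ) × List ℕ =>
        (q.1.2.applyList (L q.2)).code :=
      Primrec.encode.comp (ClosedTerm.primrec_applyList.comp (Primrec.snd.comp Primrec.fst)
        (hL.comp Primrec.snd))
    have hstage {g : (ClosedTerm ℕ × ClosedTerm ℕ) × List ℕ → ℕ} (hg : Primrec g) :
        Primrec fun r : ((ClosedTerm ℕ × ClosedTerm ℕ) × List ℕ) × ℕ =>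
          (c.evaln r.2.unpair.2 (g r.1)).isNone :=
      (Primrec.not.comp (Primrec.option_isSome.comp (Code.primrec_evaln.comp
        (((Primrec.snd.comp (Primrec.unpair.comp Primrec.snd)).pair (Primrec.const c)).pair
          (hg.comp Primrec.fst))))).of_eq fun r => by simp
    refine Partrec.bind (Computable.ofOption (Primrec.list_getElem?.comp Primrec.snd
      (Primrec.nat_sub.comp (Primrec.list_length.comp Primrec.snd)
        (Primrec.const 1))).to_comp) ?_
    refine Partrec.cond (Primrec.and.comp (hstage h1) (hstage h2)).to_comp
      (Computable.const ()).partrec ?_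
    refine Partrec.bind (Code.eval_part.comp (Computable.const c)
      (h1.to_comp.comp Computable.fst)) ?_
    refine Partrec.bind (Code.eval_part.comp (Computable.const c)
      (h2.to_comp.comp (Computable.fst.comp Computable.fst))) ?_
    exact Partrec.cond (Primrec.eq.comp (Primrec.snd.comp Primrec.fst) Primrec.snd).decide.to_comp
      (Computable.const ()).partrec Partrec.none
  have hdom : ∀ s t (h : ℕ → ℕ) n, (F ((s, t), (List.range (n + 1)).map h)).Dom ↔
      let s' := s.applyList ((List.range (n + 1)).map fun k => (h k).unpair.1)
      let t' := t.applyList ((List.range (n + 1)).map fun k => (h k).unpair.1)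
      (c.evaln (h n).unpair.2 s'.code = none ∧ c.evaln (h n).unpair.2 t'.code = none) ∨
        ∃ a, a ∈ K₁.eval s' ∧ a ∈ K₁.eval t' := by
    intro s t h n
    set s' := s.applyList ((List.range (n + 1)).map fun k => (h k).unpair.1)
    set t' := t.applyList ((List.range (n + 1)).map fun k => (h k).unpair.1)
    have hz : ((List.range (n + 1)).map h)[((List.range (n + 1)).map h).length - 1]?
        = some (h n) := by simp
    have hl : L ((List.range (n + 1)).map h) =
        (List.range (n + 1)).map fun k => (h k).unpair.1 := by
      simp [L, Function.comp_def]
    simp only [F, hz, hl, hc, Part.coe_some, Part.bind_some]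
    change (bif (c.evaln (h n).unpair.2 s'.code).isNone &&
      (c.evaln (h n).unpair.2 t'.code).isNone then _ else _ : Part Unit).Dom ↔ _
    by_cases hn : c.evaln (h n).unpair.2 s'.code = none ∧ c.evaln (h n).unpair.2 t'.code = none
    · simp [hn]
    · have hb : ((c.evaln (h n).unpair.2 s'.code).isNone &&
          (c.evaln (h n).unpair.2 t'.code).isNone) = false := by
        rw [← Bool.not_eq_true]
        simpa using hn
      rw [hb, cond_false, or_iff_right hn, Part.dom_iff_mem]
      constructor
      · rintro ⟨u, hu⟩
        obtain ⟨a, ha, hu⟩ := Part.mem_bind_iff.1 hu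
        obtain ⟨b, hb, hu⟩ := Part.mem_bind_iff.1 hu
        by_cases hab : a = b
        · exact ⟨a, ha, hab ▸ hb⟩
        · simp [hab] at hu
      · rintro ⟨a, ha, hb⟩
        exact ⟨(), Part.mem_bind_iff.2 ⟨a, ha, Part.mem_bind_iff.2 ⟨a, hb, by simp⟩⟩⟩
  refine ⟨_, ⟨_, hF.dom_re, fun _ _ => Iff.rfl⟩, ?_⟩
  rintro ⟨s, t⟩
  refine K₁.approx_iff.trans ?_
  constructor
  · intro H h
    obtain ⟨n, hn⟩ := H fun k => (h k).unpair.1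
    refine ⟨n + 1, (hdom s t h n).2 ?_⟩
    -- One more argument preserves Kleene equality and makes the prefix nonempty, so that a stage is
    -- available.
    have hn' := hn.app (h n).unpair.1
    simp only [List.range_succ, List.map_append, List.map_singleton,
      ClosedTerm.applyList_append_singleton]
    rw [PartialApplicativeStructure.KleeneEq] at hn'
    by_cases hd : ∃ a, a ∈ K₁.eval ((s.applyList ((List.range n).map fun k =>
        (h k).unpair.1)).app (ClosedTerm.elem (h n).unpair.1))
    · obtain ⟨a, ha⟩ := hd
      exact Or.inr ⟨a, ha, hn' ▸ ha⟩
    · refine Or.inl ⟨Option.eq_none_iff_forall_not_mem.2 fun a ha => hd ⟨a, ?_⟩,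
        Option.eq_none_iff_forall_not_mem.2 fun a ha => hd ⟨a, ?_⟩⟩
      · rw [← hc]
        exact Code.evaln_sound ha
      · rw [hn', ← hc]
        exact Code.evaln_sound ha
  · intro H f
    by_contra! hne
    -- Where Kleene equality fails some side converges; pairing `f` with stages that witness this
    -- defeats the first alternative at every length.
    have hstage : ∀ n, ∃ m,
        ¬ (c.evaln m (s.applyList ((List.range (n + 1)).map f)).code = none ∧
          c.evaln m (t.applyList ((List.range (n + 1)).map f)).code = none) := by
      intro n
      by_contra! hnone
      refine hne (n + 1) ?_
      have hs : ∀ a, a ∉ K₁.eval (s.applyList ((List.range (n + 1)).map f)) := fun a ha => by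
        rw [← hc] at ha
        obtain ⟨m, hm⟩ := Code.evaln_complete.1 ha
        simp [(hnone m).1] at hm
      have ht : ∀ a, a ∉ K₁.eval (t.applyList ((List.range (n + 1)).map f)) := fun a ha => by
        rw [← hc] at ha
        obtain ⟨m, hm⟩ := Code.evaln_complete.1 ha
        simp [(hnone m).2] at hm
      exact Part.ext fun a => iff_of_false (hs a) (ht a)
    choose g hg using hstage
    obtain ⟨n, hn⟩ := H fun k => Nat.pair (f k) (g k)
    cases n with
    | zero => simp [F] at hn
    | succ n =>
      have := (hdom s t _ n).1 hn
      simp only [Nat.unpair_pair] at this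
      rcases this with hnone | ⟨a, ha, hb⟩
      · exact hg n hnone
      · exact hne (n + 1) ((Part.eq_some_iff.2 ha).trans (Part.eq_some_iff.2 hb).symm)

/-! ### The relation `≈` is `Π¹₁`-hard -/

/-- For every decidable relation `D x σ` there are elements `e i x σ` of Kleene's first model,
computable and injective in the data, with `e i x σ · y = 0` if `D x σ` holds and
`e i x σ · y = e i x (σ ++ [y])` otherwise. -/
theorem exists_branching_elements {D : ℕ → List ℕ → Bool} (hD : Computable₂ D) :
    ∃ e : ℕ × ℕ × List ℕ → ℕ, Computable e ∧ Function.Injective e ∧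
      ∀ i x l y, K₁.app (e (i, x, l)) y =
        Part.some (bif D x l then 0 else e (i, x, l ++ [y])) := by
  -- Currying stores the data inside the program, which gives injectivity; the label `i` serves only
  -- to separate copies.
  let e : Code → ℕ × ℕ × List ℕ → ℕ := fun c a => encode (c.curry (encode a))
  have he : Computable₂ e :=
    (Primrec.encode.comp (Code.primrec₂_curry.comp Primrec.fst
      (Primrec.encode.comp Primrec.snd))).to_comp
  let F : Code → ℕ → ℕ := fun c n =>
    let q := ofNat ((ℕ × ℕ × List ℕ) × ℕ) n
    bif D q.1.2.1 q.1.2.2 then 0 else e c (q.1.1, q.1.2.1, q.1.2.2 ++ [q.2])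
  have hF : Computable₂ F := by
    have hq : Computable fun p : Code × ℕ => ofNat ((ℕ × ℕ × List ℕ) × ℕ) p.2 :=
      (Computable.ofNat _).comp Computable.snd
    have hq1 := Computable.fst.comp hq
    have hx := Computable.fst.comp (Computable.snd.comp hq1)
    have hl := Computable.snd.comp (Computable.snd.comp hq1)
    exact Computable.cond (hD.comp hx hl) (Computable.const 0)
      (he.comp Computable.fst ((Computable.fst.comp hq1).pair (hx.pair
        (Computable.list_concat.comp hl (Computable.snd.comp hq)))))
  obtain ⟨c, hc⟩ := Code.fixed_point₂ (f := fun c n => Part.some (F c n)) hF.partrec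
  refine ⟨e c, he.comp (Computable.const c) Computable.id, fun a b hab => ?_, ?_⟩
  · exact encode_injective (Code.curry_inj (encode_injective hab)).2
  · intro i x l y
    have hy : Nat.pair (encode (i, x, l)) y = encode ((i, x, l), y) := rfl
    simp only [K₁, e, ofNat_encode, Code.eval_curry]
    rw [hc, hy]
    simp only [F, ofNat_encode, e]

theorem isPi11Hard_approx_elem :
    IsPi11Hard fun p : ℕ × ℕ => K₁.Approx (ClosedTerm.elem p.1) (ClosedTerm.elem p.2) := by
  rintro q ⟨P, ⟨R, hR, hPR⟩, hq⟩
  obtain ⟨c, hc⟩ := Code.exists_code.1 hR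
  have hcR : ∀ x l, R (x, l) ↔ ∃ k, (c.evaln k (encode (x, l))).isSome := by
    intro x l
    have h1 : R (x, l) ↔ (c.eval (encode (x, l))).Dom := by
      rw [hc]
      simp [Part.assert]
    simp only [h1, Part.dom_iff_mem, Code.evaln_complete, Option.isSome_iff_exists,
      Option.mem_def]
    exact exists_comm
  -- The length of `l`, read as a pair `(n, k)`, asks whether `R` accepts the first `n` entries
  -- within `k` steps. Since `n` is at most the length, long prefixes of a branch test every such
  -- pair.
  let D : ℕ → List ℕ → Bool := fun x l =>
    (c.evaln l.length.unpair.2 (encode (x, l.take l.length.unpair.1))).isSome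
  have hD : Computable₂ D := by
    have hlen : Primrec fun p : ℕ × List ℕ => p.2.length.unpair :=
      Primrec.unpair.comp (Primrec.list_length.comp Primrec.snd)
    exact (Primrec.option_isSome.comp (Code.primrec_evaln.comp
      (((Primrec.snd.comp hlen).pair (Primrec.const c)).pair (Primrec.encode.comp
        (Primrec.fst.pair (Primrec.list_take.comp (Primrec.fst.comp hlen)
          Primrec.snd)))))).to_comp
  have hRD : ∀ x (f : ℕ → ℕ), (∃ n, R (x, (List.range n).map f)) ↔
      ∃ N, D x ((List.range N).map f) = true := by
    intro x f
    have htake : ∀ N, ((List.range N).map f).take N.unpair.1 = (List.range N.unpair.1).map f :=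
      fun N => by
        rw [← List.map_take, List.take_range, min_eq_left (Nat.unpair_left_le N)]
    simp only [D, List.length_map, List.length_range, htake, hcR]
    constructor
    · rintro ⟨n, k, h⟩
      exact ⟨Nat.pair n k, by simpa using h⟩
    · rintro ⟨N, h⟩
      exact ⟨_, _, h⟩
  obtain ⟨e, he, hinj, happ⟩ := exists_branching_elements hD
  have heval : ∀ i x (f : ℕ → ℕ) N, (∀ n < N, D x ((List.range n).map f) = false) →
      K₁.eval ((ClosedTerm.elem (e (i, x, []))).applyList ((List.range N).map f)) =
        Part.some (e (i, x, (List.range N).map f)) := by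
    intro i x f N
    induction N with
    | zero => exact fun _ => rfl
    | succ N ih =>
      intro h
      rw [List.range_succ, List.map_append, List.map_singleton,
        ClosedTerm.applyList_append_singleton, PartialApplicativeStructure.eval,
        ih fun n hn => h n (by omega)]
      simp [PartialApplicativeStructure.eval, happ, h N (by omega)]
  refine ⟨fun x => (e (0, x, []), e (1, x, [])), ?_, fun x => ?_⟩
  · exact (he.comp ((Computable.const 0).pair (Computable.id.pair (Computable.const [])))).pair
      (he.comp ((Computable.const 1).pair (Computable.id.pair (Computable.const []))))
  · refine (hq x).trans (Iff.trans ?_ K₁.approx_iff.symm)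
    refine forall_congr' fun f => ?_
    rw [hPR, hRD]
    constructor
    · intro h
      classical
      -- `D` need not persist along a branch, so the first accepted node is used; one further
      -- argument sends both copies to `0`.
      have hlt : ∀ n < Nat.find h, D x ((List.range n).map f) = false := fun n hn =>
        Bool.not_eq_true _ ▸ Nat.find_min h hn
      refine ⟨Nat.find h + 1, ?_⟩
      rw [PartialApplicativeStructure.KleeneEq, List.range_succ, List.map_append,
        List.map_singleton, ClosedTerm.applyList_append_singleton,
        ClosedTerm.applyList_append_singleton]
      simp only [PartialApplicativeStructure.eval]
      rw [heval _ _ _ _ hlt, heval _ _ _ _ hlt]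
      simp [happ, Nat.find_spec h]
    · rintro ⟨n, hn⟩
      by_contra! h
      have hlt : ∀ m < n, D x ((List.range m).map f) = false := fun m _ =>
        Bool.not_eq_true _ ▸ h m
      rw [PartialApplicativeStructure.KleeneEq, heval _ _ _ _ hlt, heval _ _ _ _ hlt] at hn
      -- Equal values would force the labels `0` and `1` to agree.
      simpa using hinj (Part.some_injective hn)

theorem computable_elem_prodMap : Computable fun p : ℕ × ℕ =>
    ((ClosedTerm.elem p.1, ClosedTerm.elem p.2) : ClosedTerm ℕ × ClosedTerm ℕ) :=
  ((ClosedTerm.primrec_elem.comp Primrec.fst).pair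
    (ClosedTerm.primrec_elem.comp Primrec.snd)).to_comp

end PCA

theorem mainTheorem3 :
    PCA.IsPi11Complete
      (fun p : ℕ × ℕ => PCA.K₁.Approx (PCA.ClosedTerm.elem p.1) (PCA.ClosedTerm.elem p.2)) ∧
    PCA.IsPi11Complete
      (fun p : PCA.ClosedTerm ℕ × PCA.ClosedTerm ℕ => PCA.K₁.Approx p.1 p.2) := by
  refine ⟨⟨PCA.isPi11_approx.comp PCA.computable_elem_prodMap, PCA.isPi11Hard_approx_elem⟩,
    PCA.isPi11_approx, fun q hq => ?_⟩
  exact (PCA.isPi11Hard_approx_elem q hq).trans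
    (ManyOneReducible.mk
    (fun p : PCA.ClosedTerm ℕ × PCA.ClosedTerm ℕ => PCA.K₁.Approx p.1 p.2) PCA.computable_elem_prodMap)
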